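/- Theorem 3. Let $\mathcal S$ be a finite set, $n\ge 1$, and let $\mathcal M(n)$ be the set of empirical distributions of $n$ points of $\mathcal S$, i.e. of vectors $(\alpha_s)_{s\in\mathcal S}$ with $\alpha_s\in\{0,\frac1n,\dots,1\}$ and $\sum_s\alpha_s=1$. The states of $n$ nodes evolve by $$s^i_{t+1}=f(s^i_t,m_t,w^i_t),\qquad m_t(s)=\tfrac1n\sum_{i=1}^n\mathbb 1(s^i_t=s),\qquad t=1,2,\dots$$ Collecting data at time $t$ is the action $a_t=1$, not collecting is $a_t=0$. The observations are $o_1=m_1$, and $o_{t+1}=m_{t+1}$ if $a_t=1$ and $\eta_{t+1}=1$, while $o_{t+1}=\mathtt{blank}$ otherwise, where $\mathbb P(\eta_t=1)=q\in[0,1]$ for all $t$. The noise vectors $\mathbf w_t=(w^1_t,\dots,w^n_t)$, $t\ge1$, have a common law $P_{\mathbf w}$, and $\mathbf s_1,\mathbf w_1,\mathbf w_2,\dots,\eta_1,\eta_2,\dots$ are mutually independent. A strategy $g=(g_1,g_2,\dots)$ chooses $a_t=g_t(o_{1:t},a_{1:t-1})\in\{0,1\}$. The data are estimated by $\hat m_t=h\big(\mathbb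 P(m_t\in\cdot\mid o_{1:t},a_{1:t-1})\big)\in\mathcal M(n)$ with a given function $h$, and with a discount factor $\gamma\in(0,1)$ and a per-step cost $0\le c(m,\hat m,a)\le c_{\max}$, $c_{\max}>0$, the cost of $g$ is $$J(g)=\mathbb E^g\Big[\sum_{t=1}^\infty\gamma^{t-1}c(m_t,\hat m_t,a_t)\Big].$$ Assume that the noise is exchangeable: for every permutation $\sigma$ of $\{1,\dots,n\}$, $(w^{\sigma(1)}_t,\dots,w^{\sigma(n)}_t)$ has the same law as $(w^1_t,\dots,w^n_t)$. Let $T_{\mathsf m}(m',m)=\mathbb P(m_{t+1}=m'\mid m_t=m)$ be the transition matrix of the data (for every $m\in\mathcal M(n)$ it is the probability that one step of the dynamics from any configuration with empirical distribution $m$ leads to one with empirical distribution $m'$), and let $$\hat c(x,y,a)=\sum_{m\in\mathcal M(n)}c\big(m,h(T_{\mathsf m}^{y}(\cdot,x)),a\big)\,T_{\mathsf m}^{y}(m,x).$$ Let $\varepsilon>0$, let $k$ be a nonnegative integer with $$k\ \ge\ \log\Big(\frac{(1-\gamma)\varepsilon}{2c_{\max}}\Big)\Big/\log\gamma ,$$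 let $m^*\in\mathcal M(n)$ be arbitrary, and let $\tilde V:\mathcal M(n)\times\{0,\dots,k\}\to\mathbb R$ be any solution of the truncated Bellman equation $\tilde V(x,y)=\min\big(\tilde V^0(x,y),\tilde V^1(x,y)\big)$, where, with $B(x,y)=\tilde V(x,y+1)$ if $y<k$ and $B(x,k)=\tilde V(m^*,0)$, $$\tilde V^0(x,y)=\hat c(x,y,0)+\gamma B(x,y),$$ $$\tilde V^1(x,y)=\hat c(x,y,1)+(1-q)\gamma B(x,y)+q\gamma\sum_{m'\in\mathcal M(n)}T_{\mathsf m}^{y+1}(m',x)\,\tilde V(m',0).$$ Let $g^*_\varepsilon(x,y)=0$ if $\tilde V^0(x,y)\le\tilde V^1(x,y)$ and $g^*_\varepsilon(x,y)=1$ otherwise. Write $x_t$ for the last observation up to time $t$ that is not blank, and $y_t$ for the number of blanks after it. Then there are strategies that take the action $g^*_\varepsilon(x_t,y_t)$ whenever $y_t\le k$, and every such strategy $g^*$, whatever its actions are when $y_t>k$, is $\varepsilon$-optimal: $$J(g^*)\le J(g)+\varepsilon\qquad\text{for every strategy } g .$$ -/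

import Mathlib

open MeasureTheory ProbabilityTheory

namespace SampledNetwork

/-- `EmpDist S n` is the set of empirical distributions over the finite set `S` with `n` samples:
vectors indexed by `S` with entries in `{0, 1/n, …, 1}` that sum to one. -/
@[ext]
structure EmpDist (S : Type*) [Fintype S] (n : ℕ) where
  toFun : S → ℝ
  mem_grid : ∀ s, ∃ j : ℕ, j ≤ n ∧ toFun s = (j : ℝ) / n
  sum_eq_one : ∑ s, toFun s = 1

section EmpiricalDistributions

variable {S : Type*} [Fintype S] {n : ℕ}

instance : Finite (EmpDist S n) := by
  classical
  choose j hj using fun (m : EmpDist S n) (s : S) => m.mem_grid s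
  refine Finite.of_injective
    (fun (m : EmpDist S n) (s : S) => (⟨j m s, Nat.lt_succ_of_le (hj m s).1⟩ : Fin (n + 1))) ?_
  intro a b hab
  ext s
  have h : j a s = j b s := by simpa using congrFun hab s
  rw [(hj a s).2, (hj b s).2, h]

noncomputable instance : Fintype (EmpDist S n) := Fintype.ofFinite _

noncomputable instance : DecidableEq (EmpDist S n) := Classical.decEq _

open Classical in
/-- The empirical distribution `m(s) = (1/n) ∑ᵢ 𝟙(sⁱ = s)` of a configuration of `n ≥ 1` nodes. -/
noncomputable def emp [NeZero n] (v : Fin n → S) : EmpDist S n where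
  toFun s := (1 / (n : ℝ)) * ∑ i, if v i = s then 1 else 0
  mem_grid s := by
    refine ⟨(Finset.univ.filter fun i => v i = s).card, ?_, ?_⟩
    · simpa using Finset.card_filter_le (Finset.univ : Finset (Fin n)) (fun i => v i = s)
    · rw [Finset.sum_boole]
      ring
  sum_eq_one := by
    have hn : (n : ℝ) ≠ 0 := Nat.cast_ne_zero.mpr (NeZero.ne n)
    rw [← Finset.mul_sum, Finset.sum_comm]
    simp [hn]

theorem emp_surjective [NeZero n] : Function.Surjective (emp : (Fin n → S) → EmpDist S n) := by
  classical
  intro m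
  have hn : (n : ℝ) ≠ 0 := Nat.cast_ne_zero.mpr (NeZero.ne n)
  choose j hj using m.mem_grid
  have hsum : ∑ s, j s = n := by
    have h := m.sum_eq_one
    simp only [fun s => (hj s).2] at h
    rw [← Finset.sum_div, div_eq_one_iff_eq hn] at h
    exact_mod_cast h
  have hcard : Fintype.card (Fin n) = Fintype.card (Σ s, Fin (j s)) := by simp [hsum]
  let e : Fin n ≃ (Σ s, Fin (j s)) := Fintype.equivOfCardEq hcard
  refine ⟨fun i => (e i).1, ?_⟩
  ext s
  have h1 : (∑ i, if (e i).1 = s then (1 : ℝ) else 0) = j s := by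
    rw [Equiv.sum_comp e (fun p : (Σ s, Fin (j s)) => if p.1 = s then (1 : ℝ) else 0),
      Fintype.sum_sigma, Finset.sum_eq_single s]
    · simp
    · intro b _ hb
      simp [hb]
    · simp
  have h2 : (emp fun i => (e i).1).toFun s
      = (1 / (n : ℝ)) * ∑ i, if (e i).1 = s then (1 : ℝ) else 0 := by
    simp only [emp]
  rw [h2, h1, (hj s).2]
  ring

theorem emp_comp_perm [NeZero n] (v : Fin n → S) (σ : Equiv.Perm (Fin n)) :
    emp (fun i => v (σ i)) = emp v := by
  classical
  ext s
  simp only [emp]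
  rw [Equiv.sum_comp σ (fun i => if v i = s then (1 : ℝ) else 0)]

theorem exists_perm_of_emp_eq [NeZero n] {v v' : Fin n → S} (h : emp v = emp v') :
    ∃ σ : Equiv.Perm (Fin n), ∀ i, v (σ i) = v' i := by
  classical
  have hn : (n : ℝ) ≠ 0 := Nat.cast_ne_zero.mpr (NeZero.ne n)
  have hc : ∀ s, Fintype.card {i // v' i = s} = Fintype.card {i // v i = s} := by
    intro s
    have h1 : (emp v).toFun s = (emp v').toFun s := by rw [h]
    simp only [emp] at h1
    have h2 := mul_left_cancel₀ (one_div_ne_zero hn) h1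
    rw [Finset.sum_boole, Finset.sum_boole] at h2
    rw [Fintype.card_subtype, Fintype.card_subtype]
    exact_mod_cast h2.symm
  let σ : Equiv.Perm (Fin n) := (Equiv.sigmaFiberEquiv v').symm.trans
    ((Equiv.sigmaCongrRight fun s => Fintype.equivOfCardEq (hc s)).trans (Equiv.sigmaFiberEquiv v))
  exact ⟨σ, fun i => ((Fintype.equivOfCardEq (hc (v' i))) ⟨i, rfl⟩).2⟩

end EmpiricalDistributions

/-- The data of the model: the dynamics `f` of a node, the joint law `noiseLaw` of the `n` local
noises at one time, the probability `q` that collected data are credible, the per-step cost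
`c(m, m̂, a)` (the action `true` is `a = 1`, collect the data; `false` is `a = 0`), the estimator
`h`, and the discount factor `γ`.
The estimator is evaluated at probability vectors over `EmpDist S n`; its values elsewhere are
irrelevant. -/
structure Model (S W : Type*) [Fintype S] [MeasurableSpace S] [MeasurableSpace W] (n : ℕ) where
  f : S → EmpDist S n → W → S
  measurable_f : ∀ s m, Measurable (f s m)
  noiseLaw : Measure (Fin n → W)
  noiseLaw_prob : IsProbabilityMeasure noiseLaw
  q : ℝ
  q_mem : q ∈ Set.Icc (0 : ℝ) 1
  c : EmpDist S n → EmpDist S n → Bool → ℝ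
  c_nonneg : ∀ m m' a, 0 ≤ c m m' a
  h : (EmpDist S n → ℝ) → EmpDist S n
  γ : ℝ
  γ_mem : γ ∈ Set.Ioo (0 : ℝ) 1

/-- Observations: an empirical distribution, or blank (`none`). -/
abbrev Obs (S : Type*) [Fintype S] (n : ℕ) := Option (EmpDist S n)

/-- A control strategy: the action at each time as a function of all observations up to that time
and all previous actions. Times are numbered from `0`, so at time `t` there are `t + 1` observations
and `t` previous actions. -/
def Strategy (S : Type*) [Fintype S] (n : ℕ) :=
  (t : ℕ) → (Fin (t + 1) → Obs S n) → (Fin t → Bool) → Bool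

namespace Model

variable {S W : Type*} [Fintype S] [MeasurableSpace S] [MeasurableSpace W] {n : ℕ}

/-- Exchangeable noise: the joint law of the local noises is invariant under permutations. -/
def Exchangeable (M : Model S W n) : Prop :=
  ∀ σ : Equiv.Perm (Fin n), M.noiseLaw.map (fun w i => w (σ i)) = M.noiseLaw

variable [NeZero n]

/-- One step of the dynamics of all nodes. -/
noncomputable def step (M : Model S W n) (v : Fin n → S) (w : Fin n → W) : Fin n → S :=
  fun i => M.f (v i) (emp v) (w i)

/-- The transition matrix of the empirical distribution: `M.T m' m` is the probability that the next
empirical distribution is `m'` when the current configuration has empirical distribution `m`.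
A configuration with empirical distribution `m` is chosen; see `T_emp` for the independence of the
choice. -/
noncomputable def T (M : Model S W n) : Matrix (EmpDist S n) (EmpDist S n) ℝ :=
  fun m' m => M.noiseLaw.real {w | emp (M.step (Function.surjInv emp_surjective m) w) = m'}

/-- Under exchangeable noise the transition matrix does not depend on the choice of the
configuration. -/
theorem T_emp [MeasurableSingletonClass S] (M : Model S W n) (hex : M.Exchangeable)
    (v : Fin n → S) (m' : EmpDist S n) :
    M.T m' (emp v) = M.noiseLaw.real {w | emp (M.step v w) = m'} := by
  have hmeas : MeasurableSet {w | emp (M.step v w) = m'} := by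
    have h1 : Measurable (M.step v) :=
      measurable_pi_lambda _ fun i => (M.measurable_f _ _).comp (measurable_pi_apply i)
    exact h1 (Set.toFinite {u : Fin n → S | emp u = m'}).measurableSet
  obtain ⟨σ, hσ⟩ := exists_perm_of_emp_eq
    (v := v) (v' := Function.surjInv emp_surjective (emp v))
    (Function.surjInv_eq emp_surjective (emp v)).symm
  have hmap' : Measurable fun (w : Fin n → W) i => w (σ.symm i) :=
    measurable_pi_lambda _ fun i => measurable_pi_apply (σ.symm i)
  have key : ∀ w : Fin n → W,
      emp (M.step (Function.surjInv emp_surjective (emp v)) w)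
        = emp (M.step v fun i => w (σ.symm i)) := by
    intro w
    rw [← emp_comp_perm (M.step v fun i => w (σ.symm i)) σ]
    congr 1
    funext i
    simp [step, hσ, Function.surjInv_eq emp_surjective (emp v)]
  simp only [T, key]
  conv_rhs => rw [← hex σ.symm]
  rw [map_measureReal_apply hmap' hmeas]
  rfl

/-- The expected per-step cost `ĉ(x, y, a)` given that the last credible data are `x`, received
`y` time steps ago. -/
noncomputable def cHat (M : Model S W n) (x : EmpDist S n) (y : ℕ) (a : Bool) : ℝ :=
  ∑ m, M.c m (M.h fun m' => (M.T ^ y) m' x) a * (M.T ^ y) m x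

section Truncated

variable {k : ℕ}

/-- The value after a blank observation in state `(x, y)` of the truncated space: the counter
advances if `y < k`, and the state is reset to `(mStar, 0)` if `y = k`. -/
def blankValue (mStar : EmpDist S n) (V : EmpDist S n → Fin (k + 1) → ℝ)
    (x : EmpDist S n) (y : Fin (k + 1)) : ℝ :=
  if hy : (y : ℕ) < k then V x ⟨(y : ℕ) + 1, Nat.succ_lt_succ hy⟩ else V mStar 0

/-- The value `Ṽ⁰(x, y)` of not collecting the data. -/
noncomputable def V0 (M : Model S W n) (mStar : EmpDist S n) (V : EmpDist S n → Fin (k + 1) → ℝ)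
    (x : EmpDist S n) (y : Fin (k + 1)) : ℝ :=
  M.cHat x y false + M.γ * blankValue mStar V x y

/-- The value `Ṽ¹(x, y)` of collecting the data. -/
noncomputable def V1 (M : Model S W n) (mStar : EmpDist S n) (V : EmpDist S n → Fin (k + 1) → ℝ)
    (x : EmpDist S n) (y : Fin (k + 1)) : ℝ :=
  M.cHat x y true + (1 - M.q) * M.γ * blankValue mStar V x y
    + M.q * M.γ * ∑ m', (M.T ^ ((y : ℕ) + 1)) m' x * V m' 0

/-- `V` solves the truncated Bellman equation on `EmpDist S n × {0, …, k}`. -/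
def IsBellmanSolution (M : Model S W n) (mStar : EmpDist S n)
    (V : EmpDist S n → Fin (k + 1) → ℝ) : Prop :=
  ∀ x y, V x y = min (M.V0 mStar V x y) (M.V1 mStar V x y)

open Classical in
/-- The greedy control law: collect the data exactly when `Ṽ⁰(x, y) > Ṽ¹(x, y)`. -/
noncomputable def greedy (M : Model S W n) (mStar : EmpDist S n)
    (V : EmpDist S n → Fin (k + 1) → ℝ) (x : EmpDist S n) (y : Fin (k + 1)) : Bool :=
  if M.V0 mStar V x y ≤ M.V1 mStar V x y then false else true

end Truncated

end Model

/-- Given observations `o` at times `0, …, t`, the last credible (not blank) one is `x`, and it is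
followed by exactly `y` blanks. -/
def LastCredible {S : Type*} [Fintype S] {n t : ℕ} (o : Fin (t + 1) → Obs S n)
    (x : EmpDist S n) (y : ℕ) : Prop :=
  ∃ j : Fin (t + 1), o j = some x ∧ (∀ i, j < i → o i = none) ∧ (j : ℕ) + y = t

/-- The strategy `g` applies the control law `φ` whenever the number of blanks since the last
credible data is at most `k`. Its actions in all other situations are not restricted. -/
def Strategy.Follows {S : Type*} [Fintype S] {n k : ℕ} (g : Strategy S n)
    (φ : EmpDist S n → Fin (k + 1) → Bool) : Prop :=
  ∀ (t : ℕ) (o : Fin (t + 1) → Obs S n) (a : Fin t → Bool) (x : EmpDist S n) (y : Fin (k + 1)),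
    LastCredible o x y → g t o a = φ x y

/-- Index set of the primitive random variables. -/
inductive PrimitiveIndex
  | init
  | noise (t : ℕ)
  | cred (t : ℕ)

/-- The primitive random variables of the model on a probability space `(Ω, μ)`: the initial states,
the noises at each time, with law `noiseLaw`, and the credibility variables, with success
probability `q`. All of them are mutually independent, that is, so are the σ-algebras that they
generate. -/
structure Primitives {S W : Type*} [Fintype S] [MeasurableSpace S] [MeasurableSpace W] {n : ℕ}
    (M : Model S W n) {Ω : Type*} [MeasurableSpace Ω] (μ : Measure Ω) where
  s₀ : Ω → Fin n → S
  w : ℕ → Ω → Fin n → W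
  η : ℕ → Ω → Bool
  measurable_s₀ : Measurable s₀
  measurable_w : ∀ t, Measurable (w t)
  measurable_η : ∀ t, Measurable (η t)
  law_w : ∀ t, μ.map (w t) = M.noiseLaw
  law_η : ∀ t, μ.real {ω | η t ω = true} = M.q
  indep : iIndep (fun i : PrimitiveIndex => match i with
    | .init => MeasurableSpace.comap s₀ inferInstance
    | .noise t => MeasurableSpace.comap (w t) inferInstance
    | .cred t => MeasurableSpace.comap (η t) inferInstance) μ

namespace Primitives

variable {S W : Type*} [Fintype S] [MeasurableSpace S] [MeasurableSpace W] {n : ℕ} [NeZero n]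
  {M : Model S W n} {Ω : Type*} [MeasurableSpace Ω] {μ : Measure Ω}

/-- The states of all nodes at time `t`. -/
noncomputable def state (P : Primitives M μ) : ℕ → Ω → Fin n → S
  | 0, ω => P.s₀ ω
  | t + 1, ω => M.step (state P t ω) (P.w t ω)

/-- The empirical distribution of the states at time `t`. -/
noncomputable def data (P : Primitives M μ) (t : ℕ) (ω : Ω) : EmpDist S n :=
  emp (P.state t ω)

/-- The information of the decision maker at time `t` under the strategy `g`: the observations up to
time `t` and the previous actions. The first observation is the initial empirical distribution, and
the observation at time `t + 1` is the empirical distribution at that time if the data were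
collected and are credible, and blank otherwise. -/
noncomputable def info (P : Primitives M μ) (g : Strategy S n) :
    (t : ℕ) → Ω → (Fin (t + 1) → Obs S n) × (Fin t → Bool)
  | 0, ω => (fun _ => some (P.data 0 ω), Fin.elim0)
  | t + 1, ω =>
    let I := info P g t ω
    let a := g t I.1 I.2
    (Fin.snoc I.1 (if a = true ∧ P.η (t + 1) ω = true then some (P.data (t + 1) ω) else none),
      Fin.snoc I.2 a)

/-- The action at time `t` under the strategy `g`. -/
noncomputable def action (P : Primitives M μ) (g : Strategy S n) (t : ℕ) (ω : Ω) : Bool :=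
  g t (P.info g t ω).1 (P.info g t ω).2

/-- The conditional distribution of the data at time `t` given the information of the decision maker
at time `t`. The information takes finitely many values, so the conditional probability is the
elementary one. -/
noncomputable def posterior (P : Primitives M μ) (g : Strategy S n) (t : ℕ) (ω : Ω) :
    EmpDist S n → ℝ :=
  fun m => (cond μ {ω' | P.info g t ω' = P.info g t ω}).real {ω' | P.data t ω' = m}

/-- The estimate of the data at time `t`. -/
noncomputable def estimate (P : Primitives M μ) (g : Strategy S n) (t : ℕ) (ω : Ω) : EmpDist S n :=
  M.h (P.posterior g t ω)

/-- The total expected discounted cost of the strategy `g`. -/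
noncomputable def J (P : Primitives M μ) (g : Strategy S n) : ℝ :=
  ∫ ω, ∑' t : ℕ, M.γ ^ t * M.c (P.data t ω) (P.estimate g t ω) (P.action g t ω) ∂μ

end Primitives

end SampledNetwork

open SampledNetwork

/-! The last credible data x and their age y form an information state. By exchangeability the data
are a Markov chain with matrix T, and given all observations and actions their law is column x of
T^y, whatever the strategy (`Primitives.integral_info_data`). So the conditional expected cost is
ĉ(x, y, a), and (x, y) is a controlled chain that moves to (x, y + 1) on a blank and to (m', 0) on
credible data m'.

Let C = cmax / (1 - γ), the cost of paying cmax forever. Minimum and maximum principles give 0 ≤ V ≤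
C for every Bellman solution. The truncated problem differs from the true one only after a blank at
y = k, where V(mStar, 0) replaces the true continuation. Both lie in [0, C], so the error is at most
C there, and at most γ^(k+1-y) C seen from (x, y). Accordingly V + γ^(k+1-y) C, capped at C, is
superharmonic under the greedy law (`upperValue_superharmonic`), and V - γ^(k+1-y) C, floored at 0,
is subharmonic under every action (`lowerValue_subharmonic`). The cap and the floor allow the values
C and 0 for y > k, where V is undefined and actions are arbitrary.

Discounted telescoping turns these into bounds on J(g) from above and on J(g') from below, both
integrals over the initial data. They differ by at most 2 γ^(k+1) C ≤ ε. Neither an optimal strategy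
nor the untruncated Bellman equation is needed. -/

namespace SampledNetwork

/-! ### Integration of finite-valued random variables -/

section FiniteValued

variable {Ω α : Type*} {mΩ : MeasurableSpace Ω} {μ : Measure Ω}

/-- The null fibres are finitely many, so their union is null. This keeps the denominators of
elementary conditional probabilities nonzero almost surely. -/
theorem ae_measure_fiber_ne_zero [Finite α] (X : Ω → α) :
    ∀ᵐ ω ∂μ, μ {ω' | X ω' = X ω} ≠ 0 := by
  have h : ∀ᵐ ω ∂μ, ∀ a : α, μ {ω' | X ω' = a} = 0 → X ω ≠ a := by
    rw [ae_all_iff]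
    intro a
    by_cases ha : μ {ω' | X ω' = a} = 0
    · have : ∀ᵐ ω ∂μ, X ω ≠ a := by
        rw [ae_iff]
        simpa using ha
      filter_upwards [this] with ω hω _ using hω
    · exact Filter.Eventually.of_forall fun ω h => absurd h ha
  filter_upwards [h] with ω hω h0 using hω _ h0 rfl

variable [IsFiniteMeasure μ]

theorem integral_comp_of_fintype [Fintype α] {X : Ω → α} (hX : Measurable[mΩ, ⊤] X) (f : α → ℝ) :
    ∫ ω, f (X ω) ∂μ = ∑ a, μ.real {ω | X ω = a} * f a := by
  let _ : MeasurableSpace α := ⊤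
  rw [← integral_map hX.aemeasurable (measurable_of_finite f).aestronglyMeasurable,
    integral_fintype Integrable.of_finite]
  refine Finset.sum_congr rfl fun a _ => ?_
  rw [map_measureReal_apply hX (measurableSet_singleton a), smul_eq_mul]
  rfl

theorem integrable_comp_of_finite [Finite α] {X : Ω → α} (hX : Measurable[mΩ, ⊤] X) (f : α → ℝ) :
    Integrable (fun ω => f (X ω)) μ := by
  let _ : MeasurableSpace α := ⊤
  exact Integrable.comp_measurable Integrable.of_finite hX

end FiniteValued

theorem measurable_top_prodMk {Ω α β : Type*} [Finite α] [Finite β] {m : MeasurableSpace Ω}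
    {X : Ω → α} {Y : Ω → β} (hX : Measurable[m, ⊤] X) (hY : Measurable[m, ⊤] Y) :
    Measurable[m, ⊤] fun ω => (X ω, Y ω) := by
  let _ : MeasurableSpace α := ⊤
  let _ : MeasurableSpace β := ⊤
  have h : Measurable[m] fun ω => (X ω, Y ω) := hX.prodMk hY
  exact h.mono le_rfl (fun s _ => (Set.toFinite s).measurableSet)

/-- The information of the decision maker at time `t`. -/
abbrev Info (S : Type*) [Fintype S] (n t : ℕ) := (Fin (t + 1) → Obs S n) × (Fin t → Bool)

/-! ### The information state: last credible data and their age -/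

section LastCredible

variable {S : Type*} [Fintype S] {n : ℕ}

/-- The last credible data and the number of blanks after it; the default value `d` replaces a
blank initial observation. -/
def lastCredible (d : EmpDist S n) : (t : ℕ) → (Fin (t + 1) → Obs S n) → EmpDist S n × ℕ
  | 0, o => ((o 0).getD d, 0)
  | t + 1, o =>
    match o (Fin.last (t + 1)) with
    | some x => (x, 0)
    | none => ((lastCredible d t (Fin.init o)).1, (lastCredible d t (Fin.init o)).2 + 1)

theorem lastCredible_snoc_some (d : EmpDist S n) {t : ℕ} (o : Fin (t + 1) → Obs S n)
    (x : EmpDist S n) :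
    lastCredible d (t + 1) (Fin.snoc o (some x) : Fin (t + 1 + 1) → Obs S n) = (x, 0) := by
  simp [lastCredible]

theorem lastCredible_snoc_none (d : EmpDist S n) {t : ℕ} (o : Fin (t + 1) → Obs S n) :
    lastCredible d (t + 1) (Fin.snoc o none : Fin (t + 1 + 1) → Obs S n)
      = ((lastCredible d t o).1, (lastCredible d t o).2 + 1) := by
  simp [lastCredible]

/-- Ties the relational description to the recursive one. The default `d` plays no role, since a
witness exists only if some observation is not blank. -/
theorem LastCredible.lastCredible_eq (d : EmpDist S n) {t : ℕ} {o : Fin (t + 1) → Obs S n}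
    {x : EmpDist S n} {y : ℕ} (h : LastCredible o x y) : lastCredible d t o = (x, y) := by
  induction t generalizing x y with
  | zero =>
    obtain ⟨j, hj, -, hy⟩ := h
    obtain rfl : j = 0 := by omega
    obtain rfl : y = 0 := by omega
    simp [lastCredible, hj]
  | succ t ih =>
    obtain ⟨j, hj, hb, hy⟩ := h
    induction j using Fin.lastCases with
    | last =>
      obtain rfl : y = 0 := by simpa using hy
      simp [lastCredible, hj]
    | cast j =>
      have hl : o (Fin.last (t + 1)) = none := hb _ (Fin.castSucc_lt_last j)
      obtain ⟨z, rfl⟩ : ∃ z, y = z + 1 := ⟨y - 1, by have := j.2; simp at hy; omega⟩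
      have h' : LastCredible (Fin.init o : Fin (t + 1) → Obs S n) x z := by
        refine ⟨j, hj, fun i hi => hb i.castSucc (by simpa using hi), ?_⟩
        simp at hy
        omega
      simp [lastCredible, hl, ih h']

theorem LastCredible.snoc_none {t : ℕ} {o : Fin (t + 1) → Obs S n} {x : EmpDist S n} {y : ℕ}
    (h : LastCredible o x y) :
    LastCredible (Fin.snoc o none : Fin (t + 1 + 1) → Obs S n) x (y + 1) := by
  obtain ⟨j, hj, hb, hy⟩ := h
  refine ⟨j.castSucc, by simpa using hj, fun i hi => ?_, by simp; omega⟩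
  induction i using Fin.lastCases with
  | last => simp
  | cast i => simpa using hb i (by simpa using hi)

theorem LastCredible.snoc_some {t : ℕ} (o : Fin (t + 1) → Obs S n) (x : EmpDist S n) :
    LastCredible (Fin.snoc o (some x) : Fin (t + 1 + 1) → Obs S n) x 0 :=
  ⟨Fin.last _, by simp, fun i hi => absurd hi (Fin.le_last i).not_gt, by simp⟩

end LastCredible

/-! ### Stochasticity of the transition matrix -/

namespace Model

variable {S W : Type*} [Fintype S] [MeasurableSpace S] [MeasurableSpace W] {n : ℕ}

/-- The law of the credibility variables. -/
noncomputable def credWeight (M : Model S W n) (b : Bool) : ℝ := if b then M.q else 1 - M.q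

variable [NeZero n]

theorem T_nonneg (M : Model S W n) (m' m : EmpDist S n) : 0 ≤ M.T m' m := measureReal_nonneg

theorem T_pow_nonneg (M : Model S W n) (y : ℕ) (m' m : EmpDist S n) : 0 ≤ (M.T ^ y) m' m := by
  induction y generalizing m' with
  | zero =>
    rw [pow_zero, Matrix.one_apply]
    split_ifs <;> simp
  | succ y ih =>
    rw [pow_succ', Matrix.mul_apply]
    exact Finset.sum_nonneg fun i _ => mul_nonneg (M.T_nonneg _ _) (ih _)

theorem measurable_step_right (M : Model S W n) (v : Fin n → S) : Measurable (M.step v) :=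
  measurable_pi_lambda _ fun i => (M.measurable_f _ _).comp (measurable_pi_apply i)

variable [MeasurableSingletonClass S]

theorem measurable_emp_step (M : Model S W n) (v : Fin n → S) :
    Measurable[_, ⊤] fun w => emp (M.step v w) := by
  let _ : MeasurableSpace (EmpDist S n) := ⊤
  exact (measurable_of_finite emp).comp (M.measurable_step_right v)

theorem sum_T (M : Model S W n) (m : EmpDist S n) : ∑ m', M.T m' m = 1 := by
  have := M.noiseLaw_prob
  have h := integral_comp_of_fintype (μ := M.noiseLaw)
    (M.measurable_emp_step (Function.surjInv emp_surjective m)) (fun _ => (1 : ℝ))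
  simpa [T] using h.symm

theorem sum_T_pow (M : Model S W n) (y : ℕ) (m : EmpDist S n) : ∑ m', (M.T ^ y) m' m = 1 := by
  induction y with
  | zero => simp [Matrix.one_apply]
  | succ y ih =>
    simp only [pow_succ', Matrix.mul_apply]
    rw [Finset.sum_comm]
    simp [← Finset.sum_mul, M.sum_T, ih]

end Model

/-! ### Independence of the past and the conditional law of the data -/

namespace Primitives

variable {S W : Type*} [Fintype S] [MeasurableSpace S] [MeasurableSpace W] {n : ℕ}
  {M : Model S W n} {Ω : Type*} [MeasurableSpace Ω] {μ : Measure Ω}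

/-- The σ-algebra generated by one primitive random variable. -/
abbrev primitiveSigma (P : Primitives M μ) (i : PrimitiveIndex) : MeasurableSpace Ω :=
  match i with
    | .init => MeasurableSpace.comap P.s₀ inferInstance
    | .noise t => MeasurableSpace.comap (P.w t) inferInstance
    | .cred t => MeasurableSpace.comap (P.η t) inferInstance

theorem primitiveSigma_le (P : Primitives M μ) (i : PrimitiveIndex) :
    P.primitiveSigma i ≤ ‹MeasurableSpace Ω› := by
  cases i with
  | init => exact P.measurable_s₀.comap_le
  | noise t => exact (P.measurable_w t).comap_le
  | cred t => exact (P.measurable_η t).comap_le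

/-- The indices of the primitive random variables that determine the states and the information
at time `t`. -/
def pastIndices (t : ℕ) : Set PrimitiveIndex :=
  {i | match i with
    | .init => True
    | .noise s => s < t
    | .cred s => s ≤ t}

theorem pastIndices_mono : Monotone pastIndices := by
  intro s t hst i
  cases i with
  | init => exact id
  | noise r => exact fun h => lt_of_lt_of_le h hst
  | cred r => exact fun h => le_trans h hst

/-- The σ-algebra of the past. -/
abbrev pastSigma (P : Primitives M μ) (t : ℕ) : MeasurableSpace Ω :=
  ⨆ i ∈ pastIndices t, P.primitiveSigma i

theorem pastSigma_le (P : Primitives M μ) (t : ℕ) : P.pastSigma t ≤ ‹MeasurableSpace Ω› :=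
  iSup₂_le fun i _ => P.primitiveSigma_le i

theorem pastSigma_mono (P : Primitives M μ) : Monotone P.pastSigma :=
  fun _ _ h => biSup_mono fun _ hi => pastIndices_mono h hi

theorem primitiveSigma_le_pastSigma (P : Primitives M μ) {t : ℕ} {i : PrimitiveIndex}
    (hi : i ∈ pastIndices t) : P.primitiveSigma i ≤ P.pastSigma t :=
  le_iSup₂_of_le i hi le_rfl

theorem measurable_eta_past (P : Primitives M μ) (t : ℕ) :
    Measurable[P.pastSigma t] (P.η t) :=
  (comap_measurable (P.η t)).mono
    (P.primitiveSigma_le_pastSigma (i := .cred t) (le_refl t)) le_rfl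

theorem measureReal_cred [IsProbabilityMeasure μ] (P : Primitives M μ) (t : ℕ) (b : Bool) :
    μ.real {ω | P.η t ω = b} = M.credWeight b := by
  cases b with
  | true => simpa [Model.credWeight] using P.law_η t
  | false =>
    have h : {ω | P.η t ω = false} = {ω | P.η t ω = true}ᶜ := by ext ω; simp
    have hm : MeasurableSet {ω | P.η t ω = true} :=
      P.measurable_η t (measurableSet_singleton true)
    rw [h, probReal_compl_eq_one_sub hm, P.law_η t]
    simp [Model.credWeight]

variable [NeZero n]

/-- The information at the next time as a function of the present information, the next data, and
the credibility variable. -/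
def nextInfo (g : Strategy S n) (t : ℕ) (I : Info S n t) (m : EmpDist S n) (b : Bool) :
    Info S n (t + 1) :=
  (Fin.snoc I.1 (if g t I.1 I.2 = true ∧ b = true then some m else none),
    Fin.snoc I.2 (g t I.1 I.2))

theorem info_succ (P : Primitives M μ) (g : Strategy S n) (t : ℕ) (ω : Ω) :
    P.info g (t + 1) ω = nextInfo g t (P.info g t ω) (P.data (t + 1) ω) (P.η (t + 1) ω) := rfl

variable [MeasurableSingletonClass S]

theorem measurable_state_past (P : Primitives M μ) (t : ℕ) :
    Measurable[P.pastSigma t] (P.state t) := by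
  induction t with
  | zero =>
    exact (comap_measurable P.s₀).mono
      (P.primitiveSigma_le_pastSigma (i := .init) trivial) le_rfl
  | succ t ih =>
    have h1 : Measurable[P.pastSigma (t + 1)] (P.state t) :=
      ih.mono (P.pastSigma_mono t.le_succ) le_rfl
    have h2 : Measurable[P.pastSigma (t + 1)] (P.w t) :=
      (comap_measurable (P.w t)).mono
        (P.primitiveSigma_le_pastSigma (i := .noise t) t.lt_succ_self) le_rfl
    -- There are finitely many configurations, so measurability in the noise alone suffices.
    have h3 : Measurable fun p : (Fin n → S) × (Fin n → W) => M.step p.1 p.2 :=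
      measurable_from_prod_countable_right M.measurable_step_right
    exact h3.comp (h1.prodMk h2)

theorem measurable_data_past (P : Primitives M μ) (t : ℕ) :
    Measurable[P.pastSigma t, ⊤] (P.data t) := by
  let _ : MeasurableSpace (EmpDist S n) := ⊤
  exact (measurable_of_finite emp).comp (P.measurable_state_past t)

theorem measurable_info_past (P : Primitives M μ) (g : Strategy S n) (t : ℕ) :
    Measurable[P.pastSigma t, ⊤] (P.info g t) := by
  induction t with
  | zero =>
    let _ : MeasurableSpace (Info S n 0) := ⊤
    exact (measurable_from_top (f := fun m : EmpDist S n =>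
      ((fun _ => some m, Fin.elim0) : Info S n 0))).comp (P.measurable_data_past 0)
  | succ t ih =>
    have h := measurable_top_prodMk (ih.mono (P.pastSigma_mono t.le_succ) le_rfl)
      (measurable_top_prodMk (P.measurable_data_past (t + 1)) (P.measurable_eta_past (t + 1)))
    let _ : MeasurableSpace (Info S n (t + 1)) := ⊤
    exact (measurable_from_top (f := fun p : Info S n t × EmpDist S n × Bool =>
      nextInfo g t p.1 p.2.1 p.2.2)).comp h

theorem measurable_info (P : Primitives M μ) (g : Strategy S n) (t : ℕ) :
    Measurable[_, ⊤] (P.info g t) :=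
  (P.measurable_info_past g t).mono (P.pastSigma_le t) le_rfl

theorem measurable_data (P : Primitives M μ) (t : ℕ) : Measurable[_, ⊤] (P.data t) :=
  (P.measurable_data_past t).mono (P.pastSigma_le t) le_rfl

variable [IsProbabilityMeasure μ]

/-- The past at time t involves noises before t but credibility variables up to t. Thus `w t` and `η
(t + 1)` are independent of it and of each other, and exchangeability lets the transition
probability depend on v only through `emp v`. -/
theorem measureReal_past_inter (P : Primitives M μ) (hex : M.Exchangeable) (t : ℕ) {A : Set Ω}
    (hA : MeasurableSet[P.pastSigma t] A) (v : Fin n → S) (m' : EmpDist S n) (b : Bool) :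
    μ.real (A ∩ ({ω | emp (M.step v (P.w t ω)) = m'} ∩ {ω | P.η (t + 1) ω = b}))
      = μ.real A * (M.T m' (emp v) * M.credWeight b) := by
  have hind : iIndep P.primitiveSigma μ := P.indep
  have hdisj : Disjoint (pastIndices t) {.noise t, .cred (t + 1)} := by
    rw [Set.disjoint_right]
    rintro i (rfl | rfl) <;> simp [pastIndices]
  have h1 := indep_iSup_of_disjoint P.primitiveSigma_le hind hdisj
  have h2 : Indep (P.primitiveSigma (.noise t)) (P.primitiveSigma (.cred (t + 1))) μ :=
    hind.indep (by simp)
  have hset : MeasurableSet {w | emp (M.step v w) = m'} :=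
    M.measurable_emp_step v (MeasurableSpace.measurableSet_top (s := {m'}))
  have hN : MeasurableSet[P.primitiveSigma (.noise t)] {ω | emp (M.step v (P.w t ω)) = m'} :=
    ⟨{w | emp (M.step v w) = m'}, hset, rfl⟩
  have hC : MeasurableSet[P.primitiveSigma (.cred (t + 1))] {ω | P.η (t + 1) ω = b} :=
    ⟨{b}, measurableSet_singleton b, rfl⟩
  have hNC : MeasurableSet[⨆ i ∈ ({.noise t, .cred (t + 1)} : Set PrimitiveIndex),
      P.primitiveSigma i] ({ω | emp (M.step v (P.w t ω)) = m'} ∩ {ω | P.η (t + 1) ω = b}) := by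
    refine MeasurableSet.inter ?_ ?_
    · exact le_iSup₂_of_le (f := fun i _ => P.primitiveSigma i) (.noise t) (by simp) le_rfl _ hN
    · exact le_iSup₂_of_le (f := fun i _ => P.primitiveSigma i) (.cred (t + 1)) (by simp) le_rfl _ hC
  have e1 := (Indep_iff _ _ _).1 h1 _ _ hA hNC
  have e2 := (Indep_iff _ _ _).1 h2 _ _ hN hC
  have e3 : μ.real {ω | emp (M.step v (P.w t ω)) = m'} = M.T m' (emp v) := by
    rw [M.T_emp hex, ← P.law_w t, map_measureReal_apply (P.measurable_w t) hset]
    rfl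
  rw [measureReal_def, e1, e2, ENNReal.toReal_mul, ENNReal.toReal_mul, ← measureReal_def,
    ← measureReal_def, ← measureReal_def, e3, P.measureReal_cred]

/-- The next data and the next credibility variable, given the information and the present data. -/
theorem integral_next (P : Primitives M μ) (hex : M.Exchangeable) (g : Strategy S n) (t : ℕ)
    (ψ : Info S n t → EmpDist S n → Bool → ℝ) :
    ∫ ω, ψ (P.info g t ω) (P.data (t + 1) ω) (P.η (t + 1) ω) ∂μ
      = ∫ ω, ∑ m', ∑ b, M.T m' (P.data t ω) * M.credWeight b * ψ (P.info g t ω) m' b ∂μ := by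
  classical
  have hstate : Measurable[P.pastSigma t, ⊤] (P.state t) :=
    (P.measurable_state_past t).mono le_rfl (fun s _ => (Set.toFinite s).measurableSet)
  -- The full configuration is kept, because the next data are a function of it and the noise; both
  -- sides are then compared atom by atom.
  have hH := measurable_top_prodMk (P.measurable_info_past g t) hstate
  have hH' := hH.mono (P.pastSigma_le t) le_rfl
  have hη : Measurable[_, ⊤] (P.η (t + 1)) := P.measurable_η (t + 1)
  have hR := measurable_top_prodMk hH' (measurable_top_prodMk (P.measurable_data (t + 1)) hη)
  have e1 := integral_comp_of_fintype (μ := μ) hR (fun p => ψ p.1.1 p.2.1 p.2.2)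
  have e2 := integral_comp_of_fintype (μ := μ) hH'
    (fun p => ∑ m', ∑ b, M.T m' (emp p.2) * M.credWeight b * ψ p.1 m' b)
  refine e1.trans (Eq.trans ?_ e2.symm)
  rw [Fintype.sum_prod_type]
  refine Finset.sum_congr rfl fun p _ => ?_
  rw [Fintype.sum_prod_type, Finset.mul_sum]
  refine Finset.sum_congr rfl fun m' _ => ?_
  rw [Finset.mul_sum]
  refine Finset.sum_congr rfl fun b _ => ?_
  have hA : MeasurableSet[P.pastSigma t] {ω | (P.info g t ω, P.state t ω) = p} :=
    hH (MeasurableSpace.measurableSet_top (s := {p}))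
  have hset : {ω | ((P.info g t ω, P.state t ω), P.data (t + 1) ω, P.η (t + 1) ω) = (p, m', b)}
      = {ω | (P.info g t ω, P.state t ω) = p} ∩
        ({ω | emp (M.step p.2 (P.w t ω)) = m'} ∩ {ω | P.η (t + 1) ω = b}) := by
    ext ω
    obtain ⟨I, v⟩ := p
    simp only [Set.mem_ofPred_eq, Set.mem_inter_iff, Prod.mk.injEq]
    refine and_congr_right fun h => ?_
    simp [data, state, h.2]
  rw [hset, P.measureReal_past_inter hex t hA]
  ring

/-- The joint law of the information, the next data and the next credibility variable, provided
that the conditional law of the present data given the information is a power of the transition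
matrix. -/
theorem integral_info_next_of_integral_info_data (P : Primitives M μ) (hex : M.Exchangeable)
    (g : Strategy S n) (d : EmpDist S n) (t : ℕ)
    (h : ∀ φ : Info S n t → EmpDist S n → ℝ,
      ∫ ω, φ (P.info g t ω) (P.data t ω) ∂μ
        = ∫ ω, ∑ m, (M.T ^ (lastCredible d t (P.info g t ω).1).2) m
            (lastCredible d t (P.info g t ω).1).1 * φ (P.info g t ω) m ∂μ)
    (ψ : Info S n t → EmpDist S n → Bool → ℝ) :
    ∫ ω, ψ (P.info g t ω) (P.data (t + 1) ω) (P.η (t + 1) ω) ∂μ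
      = ∫ ω, ∑ m', ∑ b, (M.T ^ ((lastCredible d t (P.info g t ω).1).2 + 1)) m'
          (lastCredible d t (P.info g t ω).1).1 * M.credWeight b
            * ψ (P.info g t ω) m' b ∂μ := by
  rw [P.integral_next hex g t ψ,
    h (fun I m => ∑ m', ∑ b, M.T m' m * M.credWeight b * ψ I m' b)]
  congr 1
  funext ω
  simp only [pow_succ', Matrix.mul_apply, Finset.mul_sum, Finset.sum_mul]
  rw [Finset.sum_comm]
  refine Finset.sum_congr rfl fun m' _ => ?_
  rw [Finset.sum_comm]
  refine Finset.sum_congr rfl fun b _ => Finset.sum_congr rfl fun m _ => ?_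
  ring

/-- Given the information, the data are distributed according to a power of the transition
matrix. -/
theorem integral_info_data (P : Primitives M μ) (hex : M.Exchangeable) (g : Strategy S n)
    (d : EmpDist S n) (t : ℕ) (φ : Info S n t → EmpDist S n → ℝ) :
    ∫ ω, φ (P.info g t ω) (P.data t ω) ∂μ
      = ∫ ω, ∑ m, (M.T ^ (lastCredible d t (P.info g t ω).1).2) m
          (lastCredible d t (P.info g t ω).1).1 * φ (P.info g t ω) m ∂μ := by
  induction t with
  | zero => simp [info, lastCredible, Matrix.one_apply]
  | succ t ih =>
    -- Both sides at time t + 1 are functionals of the old information, the new data and the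
    -- credibility variable, so the same identity rewrites each.
    have key := P.integral_info_next_of_integral_info_data hex g d t ih
    simp only [info_succ]
    rw [key (fun I m b => φ (nextInfo g t I m b) m),
      key (fun I m b => ∑ m', (M.T ^ (lastCredible d (t + 1) (nextInfo g t I m b).1).2) m'
          (lastCredible d (t + 1) (nextInfo g t I m b).1).1 * φ (nextInfo g t I m b) m')]
    congr 1
    funext ω
    rw [Finset.sum_comm, Finset.sum_comm (γ := EmpDist S n)]
    refine Finset.sum_congr rfl fun b _ => ?_
    -- Credible data reset the age, and T^0 is a point mass. After a blank the new information does
    -- not depend on the hidden data, whose weights sum to one.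
    by_cases h : g t (P.info g t ω).1 (P.info g t ω).2 = true ∧ b = true
    · simp [nextInfo, h, lastCredible_snoc_some, Matrix.one_apply]
    · simp only [nextInfo, h, lastCredible_snoc_none, if_false]
      rw [← Finset.sum_mul, ← Finset.sum_mul, M.sum_T_pow, one_mul, Finset.mul_sum]
      refine Finset.sum_congr rfl fun m _ => ?_
      ring

/-- The joint law of the information, the next data and the next credibility variable. -/
theorem integral_info_next (P : Primitives M μ) (hex : M.Exchangeable) (g : Strategy S n)
    (d : EmpDist S n) (t : ℕ) (ψ : Info S n t → EmpDist S n → Bool → ℝ) :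
    ∫ ω, ψ (P.info g t ω) (P.data (t + 1) ω) (P.η (t + 1) ω) ∂μ
      = ∫ ω, ∑ m', ∑ b, (M.T ^ ((lastCredible d t (P.info g t ω).1).2 + 1)) m'
          (lastCredible d t (P.info g t ω).1).1 * M.credWeight b
            * ψ (P.info g t ω) m' b ∂μ :=
  P.integral_info_next_of_integral_info_data hex g d t (P.integral_info_data hex g d t) ψ

end Primitives

/-! ### Bellman solutions and their comparison functions -/

namespace Model

variable {S W : Type*} [Fintype S] [MeasurableSpace S] [MeasurableSpace W] {n : ℕ}

/-- The probability of a credible observation under an action. -/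
noncomputable def successProb (M : Model S W n) (a : Bool) : ℝ := if a then M.q else 0

theorem successProb_nonneg (M : Model S W n) (a : Bool) : 0 ≤ M.successProb a := by
  cases a
  · simp [successProb]
  · simpa [successProb] using M.q_mem.1

theorem successProb_le_one (M : Model S W n) (a : Bool) : M.successProb a ≤ 1 := by
  cases a
  · simp [successProb]
  · simpa [successProb] using M.q_mem.2

theorem le_blankValue {S : Type*} [Fintype S] {n k : ℕ} {mStar : EmpDist S n}
    {V : EmpDist S n → Fin (k + 1) → ℝ} {r : ℝ}
    (h : ∀ x y, r ≤ V x y) (x : EmpDist S n) (y : Fin (k + 1)) : r ≤ blankValue mStar V x y := by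
  rw [blankValue]
  split_ifs <;> exact h _ _

theorem blankValue_le {S : Type*} [Fintype S] {n k : ℕ} {mStar : EmpDist S n}
    {V : EmpDist S n → Fin (k + 1) → ℝ} {r : ℝ}
    (h : ∀ x y, V x y ≤ r) (x : EmpDist S n) (y : Fin (k + 1)) : blankValue mStar V x y ≤ r := by
  rw [blankValue]
  split_ifs <;> exact h _ _

section Bounds

variable (M : Model S W n) {k : ℕ} (V : EmpDist S n → Fin (k + 1) → ℝ) (C : ℝ)

/-- An upper bound for the cost of a strategy that follows the greedy control law. -/
noncomputable def upperValue (x : EmpDist S n) (y : ℕ) : ℝ :=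
  if h : y < k + 1 then min C (V x ⟨y, h⟩ + M.γ ^ (k + 1 - y) * C) else C

/-- A lower bound for the cost of all strategies. -/
noncomputable def lowerValue (x : EmpDist S n) (y : ℕ) : ℝ :=
  if h : y < k + 1 then max 0 (V x ⟨y, h⟩ - M.γ ^ (k + 1 - y) * C) else 0

variable {V C}

theorem upperValue_le (x : EmpDist S n) (y : ℕ) : M.upperValue V C x y ≤ C := by
  rw [upperValue]
  split_ifs
  · exact min_le_left _ _
  · exact le_rfl

theorem lowerValue_nonneg (x : EmpDist S n) (y : ℕ) : 0 ≤ M.lowerValue V C x y := by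
  rw [lowerValue]
  split_ifs
  · exact le_max_left _ _
  · exact le_rfl

theorem upperValue_zero_le (x : EmpDist S n) :
    M.upperValue V C x 0 ≤ V x 0 + M.γ ^ (k + 1) * C := by
  simp [upperValue]

theorem le_lowerValue_zero (x : EmpDist S n) :
    V x 0 - M.γ ^ (k + 1) * C ≤ M.lowerValue V C x 0 := by
  simp [lowerValue]

/-- For y < k both sides advance the counter. At y = k the left side is C while V resets to mStar;
the error term is then γ^0 C = C, which suffices as V ≥ 0. -/
theorem upperValue_succ_le_blankValue (mStar : EmpDist S n) (hV0 : ∀ x y, 0 ≤ V x y)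
    (x : EmpDist S n) (y : Fin (k + 1)) :
    M.upperValue V C x (y + 1) ≤ blankValue mStar V x y + M.γ ^ (k - y) * C := by
  rw [upperValue, blankValue]
  by_cases h : (y : ℕ) < k
  · rw [dif_pos h, dif_pos (Nat.succ_lt_succ h), Nat.add_sub_add_right]
    exact min_le_right _ _
  · have hy : k - (y : ℕ) = 0 := by omega
    rw [dif_neg h, dif_neg (by omega), hy, pow_zero, one_mul]
    linarith [hV0 mStar 0]

/-- The dual estimate: at y = k the lower value is 0, and V ≤ C absorbs the reset. -/
theorem blankValue_le_lowerValue_succ (mStar : EmpDist S n) (hVC : ∀ x y, V x y ≤ C)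
    (x : EmpDist S n) (y : Fin (k + 1)) :
    blankValue mStar V x y ≤ M.lowerValue V C x (y + 1) + M.γ ^ (k - y) * C := by
  rw [lowerValue, blankValue]
  by_cases h : (y : ℕ) < k
  · rw [dif_pos h, dif_pos (Nat.succ_lt_succ h), Nat.add_sub_add_right, ← sub_le_iff_le_add]
    exact le_max_right _ _
  · have hy : k - (y : ℕ) = 0 := by omega
    rw [dif_neg h, dif_neg (by omega), hy, pow_zero, one_mul]
    linarith [hVC mStar 0]

theorem pow_mul_le_pow_mul (hC0 : 0 ≤ C) {i j : ℕ} (h : i ≤ j) :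
    M.γ ^ j * C ≤ M.γ ^ i * C :=
  mul_le_mul_of_nonneg_right (pow_le_pow_of_le_one M.γ_mem.1.le M.γ_mem.2.le h) hC0

end Bounds

variable [NeZero n]

/-- The expected value after taking the action `a` in state `(x, y)`, if a blank observation has
value `β` and the credible observation `m` has value `v m`. -/
noncomputable def expectedNext (M : Model S W n) (x : EmpDist S n) (y : ℕ) (a : Bool) (β : ℝ)
    (v : EmpDist S n → ℝ) : ℝ :=
  (1 - M.successProb a) * β + M.successProb a * ∑ m', (M.T ^ (y + 1)) m' x * v m'

/-- The value of taking the action `a` in a state of the truncated space. -/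
noncomputable def actionValue (M : Model S W n) {k : ℕ} (mStar : EmpDist S n)
    (V : EmpDist S n → Fin (k + 1) → ℝ) (x : EmpDist S n) (y : Fin (k + 1)) (a : Bool) : ℝ :=
  M.cHat x y a + M.γ * M.expectedNext x y a (blankValue mStar V x y) fun m => V m 0

theorem V0_eq_actionValue (M : Model S W n) {k : ℕ} (mStar : EmpDist S n)
    (V : EmpDist S n → Fin (k + 1) → ℝ) (x : EmpDist S n) (y : Fin (k + 1)) :
    M.V0 mStar V x y = M.actionValue mStar V x y false := by
  simp [V0, actionValue, expectedNext, successProb]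

theorem V1_eq_actionValue (M : Model S W n) {k : ℕ} (mStar : EmpDist S n)
    (V : EmpDist S n → Fin (k + 1) → ℝ) (x : EmpDist S n) (y : Fin (k + 1)) :
    M.V1 mStar V x y = M.actionValue mStar V x y true := by
  simp only [V1, actionValue, expectedNext, successProb, if_true]
  ring

theorem IsBellmanSolution.le_actionValue {M : Model S W n} {k : ℕ} {mStar : EmpDist S n}
    {V : EmpDist S n → Fin (k + 1) → ℝ} (hV : M.IsBellmanSolution mStar V) (x : EmpDist S n)
    (y : Fin (k + 1)) (a : Bool) : V x y ≤ M.actionValue mStar V x y a := by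
  rw [hV x y]
  cases a
  · exact (min_le_left _ _).trans_eq (M.V0_eq_actionValue mStar V x y)
  · exact (min_le_right _ _).trans_eq (M.V1_eq_actionValue mStar V x y)

theorem IsBellmanSolution.eq_actionValue_greedy {M : Model S W n} {k : ℕ} {mStar : EmpDist S n}
    {V : EmpDist S n → Fin (k + 1) → ℝ} (hV : M.IsBellmanSolution mStar V) (x : EmpDist S n)
    (y : Fin (k + 1)) : V x y = M.actionValue mStar V x y (M.greedy mStar V x y) := by
  rw [hV x y, greedy]
  split_ifs with h
  · rw [min_eq_left h, V0_eq_actionValue]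
  · rw [min_eq_right (not_le.1 h).le, V1_eq_actionValue]

theorem cHat_nonneg [MeasurableSingletonClass S] (M : Model S W n) (x : EmpDist S n) (y : ℕ)
    (a : Bool) : 0 ≤ M.cHat x y a :=
  Finset.sum_nonneg fun _ _ => mul_nonneg (M.c_nonneg _ _ _) (M.T_pow_nonneg _ _ _)

variable [MeasurableSingletonClass S]

theorem cHat_le (M : Model S W n) {cmax : ℝ} (hc : ∀ m m' a, M.c m m' a ≤ cmax)
    (x : EmpDist S n) (y : ℕ) (a : Bool) : M.cHat x y a ≤ cmax := by
  calc M.cHat x y a ≤ ∑ m, cmax * (M.T ^ y) m x :=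
        Finset.sum_le_sum fun _ _ => mul_le_mul_of_nonneg_right (hc _ _ _) (M.T_pow_nonneg _ _ _)
    _ = cmax := by rw [← Finset.mul_sum, M.sum_T_pow, mul_one]

/-- The weights are nonnegative and sum to one, so a uniform error δ passes through; δ = 0 is
monotonicity. -/
theorem expectedNext_le (M : Model S W n) (x : EmpDist S n) (y : ℕ) (a : Bool) {β β' δ : ℝ}
    {v v' : EmpDist S n → ℝ} (hβ : β ≤ β' + δ) (hv : ∀ m, v m ≤ v' m + δ) :
    M.expectedNext x y a β v ≤ M.expectedNext x y a β' v' + δ := by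
  have h1 : ∑ m', (M.T ^ (y + 1)) m' x * v m' ≤ ∑ m', (M.T ^ (y + 1)) m' x * v' m' + δ := by
    calc ∑ m', (M.T ^ (y + 1)) m' x * v m' ≤ ∑ m', (M.T ^ (y + 1)) m' x * (v' m' + δ) :=
          Finset.sum_le_sum fun _ _ => mul_le_mul_of_nonneg_left (hv _) (M.T_pow_nonneg _ _ _)
      _ = _ := by simp [mul_add, Finset.sum_add_distrib, ← Finset.sum_mul, M.sum_T_pow]
  have h2 := mul_le_mul_of_nonneg_left h1 (M.successProb_nonneg a)
  have h3 := mul_le_mul_of_nonneg_left hβ (sub_nonneg.2 (M.successProb_le_one a))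
  simp only [expectedNext]
  linarith

theorem expectedNext_const (M : Model S W n) (x : EmpDist S n) (y : ℕ) (a : Bool) (r : ℝ) :
    M.expectedNext x y a r (fun _ => r) = r := by
  simp only [expectedNext, ← Finset.sum_mul, M.sum_T_pow]
  ring

/-- Minimum principle: at a minimiser the Bellman equation gives min V ≥ γ min V, and γ < 1. -/
theorem IsBellmanSolution.nonneg {M : Model S W n} {k : ℕ} {mStar : EmpDist S n}
    {V : EmpDist S n → Fin (k + 1) → ℝ} (hV : M.IsBellmanSolution mStar V) (x : EmpDist S n)
    (y : Fin (k + 1)) : 0 ≤ V x y := by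
  have : Nonempty (EmpDist S n) := ⟨mStar⟩
  obtain ⟨⟨x₀, y₀⟩, h₀⟩ := Finite.exists_min fun p : EmpDist S n × Fin (k + 1) => V p.1 p.2
  have h₁ : ∀ x y, V x₀ y₀ ≤ V x y := fun x y => h₀ (x, y)
  refine le_trans ?_ (h₁ x y)
  have h2 := M.expectedNext_le x₀ y₀ (M.greedy mStar V x₀ y₀) (δ := 0)
    (v := fun _ => V x₀ y₀) (v' := fun m => V m 0)
    (by simpa using le_blankValue (mStar := mStar) h₁ x₀ y₀) (fun m => by simpa using h₁ m 0)
  rw [M.expectedNext_const, add_zero] at h2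
  have h3 := mul_le_mul_of_nonneg_left h2 M.γ_mem.1.le
  have h4 := M.cHat_nonneg x₀ y₀ (M.greedy mStar V x₀ y₀)
  have h5 := hV.eq_actionValue_greedy x₀ y₀
  rw [actionValue] at h5
  have h6 := M.γ_mem.2
  by_contra hneg
  nlinarith

/-- Maximum principle: at a maximiser max V ≤ cmax + γ max V. One fixed action suffices, as V is
below every action value. -/
theorem IsBellmanSolution.le_bound {M : Model S W n} {k : ℕ} {mStar : EmpDist S n}
    {V : EmpDist S n → Fin (k + 1) → ℝ} (hV : M.IsBellmanSolution mStar V) {cmax C : ℝ}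
    (hc : ∀ m m' a, M.c m m' a ≤ cmax) (hC : cmax + M.γ * C = C) (x : EmpDist S n)
    (y : Fin (k + 1)) : V x y ≤ C := by
  have : Nonempty (EmpDist S n) := ⟨mStar⟩
  obtain ⟨⟨x₀, y₀⟩, h₀⟩ := Finite.exists_max fun p : EmpDist S n × Fin (k + 1) => V p.1 p.2
  have h₁ : ∀ x y, V x y ≤ V x₀ y₀ := fun x y => h₀ (x, y)
  refine (h₁ x y).trans ?_
  have h2 := M.expectedNext_le x₀ y₀ false (δ := 0)
    (v' := fun _ => V x₀ y₀) (v := fun m => V m 0)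
    (by simpa using blankValue_le (mStar := mStar) h₁ x₀ y₀) (fun m => by simpa using h₁ m 0)
  rw [M.expectedNext_const, add_zero] at h2
  have h3 := mul_le_mul_of_nonneg_left h2 M.γ_mem.1.le
  have h4 := M.cHat_le hc x₀ y₀ false
  have h5 := hV.le_actionValue x₀ y₀ false
  rw [actionValue] at h5
  have h6 := M.γ_mem.2
  by_contra hneg
  nlinarith

variable {M : Model S W n} {k : ℕ} {V : EmpDist S n → Fin (k + 1) → ℝ} {C : ℝ}

/-- The upper value decreases in expectation along the greedy control law. -/
theorem IsBellmanSolution.upperValue_superharmonic {mStar : EmpDist S n}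
    (hV : M.IsBellmanSolution mStar V) {cmax : ℝ} (hc : ∀ m m' a, M.c m m' a ≤ cmax)
    (hC : cmax + M.γ * C = C) (hC0 : 0 ≤ C) (x : EmpDist S n) (y : ℕ) (a : Bool)
    (ha : ∀ h : y < k + 1, a = M.greedy mStar V x ⟨y, h⟩) :
    M.cHat x y a + M.γ * M.expectedNext x y a (M.upperValue V C x (y + 1))
        (fun m => M.upperValue V C m 0) ≤ M.upperValue V C x y := by
  -- Since the upper value never exceeds C and cmax + γ C = C, this holds for every action; it
  -- settles y > k and the cap.
  have hle : M.cHat x y a + M.γ * M.expectedNext x y a (M.upperValue V C x (y + 1))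
        (fun m => M.upperValue V C m 0) ≤ C := by
    have h1 := M.expectedNext_le x y a (δ := 0) (v' := fun _ => C)
      (by simpa using M.upperValue_le (V := V) (C := C) x (y + 1))
      (fun m => by simpa using M.upperValue_le (V := V) (C := C) m 0)
    rw [M.expectedNext_const, add_zero] at h1
    have h2 := mul_le_mul_of_nonneg_left h1 M.γ_mem.1.le
    linarith [M.cHat_le hc x y a]
  conv_rhs => rw [upperValue]
  split_ifs with h
  · refine le_min hle ?_
    -- The blank branch dictates this error; the credible branch has only γ^(k+1) C. Discounting
    -- then supplies the missing factor γ.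
    have h1 := M.expectedNext_le x y a (δ := M.γ ^ (k - y) * C) (v' := fun m => V m 0)
      (M.upperValue_succ_le_blankValue (C := C) mStar hV.nonneg x ⟨y, h⟩)
      (fun m => (M.upperValue_zero_le (V := V) (C := C) m).trans
        (by linarith [M.pow_mul_le_pow_mul hC0 (show k - y ≤ k + 1 by omega)]))
    have h2 := mul_le_mul_of_nonneg_left h1 M.γ_mem.1.le
    have h3 := hV.eq_actionValue_greedy x ⟨y, h⟩
    rw [← ha h, actionValue] at h3
    rw [show k + 1 - y = (k - y) + 1 by omega, pow_succ']
    dsimp only at h1 h2 h3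
    linarith
  · exact hle

/-- The lower value increases in expectation under every action. -/
theorem IsBellmanSolution.lowerValue_subharmonic {mStar : EmpDist S n}
    (hV : M.IsBellmanSolution mStar V) (hVC : ∀ x y, V x y ≤ C) (hC0 : 0 ≤ C)
    (x : EmpDist S n) (y : ℕ) (a : Bool) :
    M.lowerValue V C x y ≤ M.cHat x y a + M.γ * M.expectedNext x y a
      (M.lowerValue V C x (y + 1)) (fun m => M.lowerValue V C m 0) := by
  have hle : 0 ≤ M.cHat x y a + M.γ * M.expectedNext x y a
      (M.lowerValue V C x (y + 1)) (fun m => M.lowerValue V C m 0) := by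
    have h1 := M.expectedNext_le x y a (δ := 0) (v := fun _ => 0)
      (by simpa using M.lowerValue_nonneg (V := V) (C := C) x (y + 1))
      (fun m => by simpa using M.lowerValue_nonneg (V := V) (C := C) m 0)
    rw [M.expectedNext_const, add_zero] at h1
    exact add_nonneg (M.cHat_nonneg x y a) (mul_nonneg M.γ_mem.1.le h1)
  conv_lhs => rw [lowerValue]
  split_ifs with h
  · refine max_le hle ?_
    have h1 := M.expectedNext_le x y a (δ := M.γ ^ (k - y) * C) (v := fun m => V m 0)
      (v' := fun m => M.lowerValue V C m 0)
      (M.blankValue_le_lowerValue_succ (C := C) mStar hVC x ⟨y, h⟩)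
      (fun m => (sub_le_iff_le_add.1 (M.le_lowerValue_zero (V := V) (C := C) m)).trans
        (by linarith [M.pow_mul_le_pow_mul hC0 (show k - y ≤ k + 1 by omega)]))
    have h2 := mul_le_mul_of_nonneg_left h1 M.γ_mem.1.le
    have h3 := hV.le_actionValue x ⟨y, h⟩ a
    rw [actionValue] at h3
    rw [show k + 1 - y = (k - y) + 1 by omega, pow_succ']
    dsimp only at h1 h2 h3
    linarith
  · exact hle

end Model

/-- Weighting step t by γ^t makes the sum telescope, and the remainder γ^N E(N) vanishes because E
is bounded. -/
theorem le_of_discounted_step_le {γ K c : ℝ} (hγ0 : 0 ≤ γ) (hγ1 : γ < 1) {e E : ℕ → ℝ}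
    (hstep : ∀ t, e t + γ * E (t + 1) ≤ E t) (hE : ∀ t, |E t| ≤ K)
    (hsum : HasSum (fun t => γ ^ t * e t) c) : c ≤ E 0 := by
  have h1 : ∀ N, ∑ t ∈ Finset.range N, γ ^ t * e t ≤ E 0 - γ ^ N * E N := by
    intro N
    induction N with
    | zero => simp
    | succ N ih =>
      rw [Finset.sum_range_succ, pow_succ]
      have := mul_le_mul_of_nonneg_left (hstep N) (pow_nonneg hγ0 N)
      linarith
  have h2 : ∀ N, ∑ t ∈ Finset.range N, γ ^ t * e t ≤ E 0 + γ ^ N * K := by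
    intro N
    have := mul_le_mul_of_nonneg_left (abs_le.1 (hE N)).1 (pow_nonneg hγ0 N)
    linarith [h1 N]
  have h3 : Filter.Tendsto (fun N : ℕ => E 0 + γ ^ N * K) Filter.atTop (nhds (E 0)) := by
    simpa using ((tendsto_pow_atTop_nhds_zero_of_lt_one hγ0 hγ1).mul_const K).const_add (E 0)
  exact le_of_tendsto_of_tendsto' hsum.tendsto_sum_nat h3 h2

theorem Strategy.exists_follows {S : Type*} [Fintype S] {n k : ℕ} (d : EmpDist S n)
    (φ : EmpDist S n → Fin (k + 1) → Bool) : ∃ g : Strategy S n, g.Follows φ := by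
  refine ⟨fun t o _ => if h : (lastCredible d t o).2 < k + 1 then
    φ (lastCredible d t o).1 ⟨(lastCredible d t o).2, h⟩ else false, ?_⟩
  intro t o a x y h
  simp only [h.lastCredible_eq d, y.isLt, dif_pos]

/-! ### The cost of a strategy in terms of the information state -/

namespace Primitives

variable {S W : Type*} [Fintype S] [MeasurableSpace S] [MeasurableSpace W] {n : ℕ} [NeZero n]
  {M : Model S W n} {Ω : Type*} [MeasurableSpace Ω] {μ : Measure Ω}

theorem exists_lastCredible_info (P : Primitives M μ) (g : Strategy S n) (t : ℕ) (ω : Ω) :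
    ∃ x y, LastCredible (P.info g t ω).1 x y := by
  induction t with
  | zero =>
    exact ⟨P.data 0 ω, 0, 0, rfl,
      fun i hi => absurd hi (by simp [Subsingleton.elim (α := Fin 1) i 0]), rfl⟩
  | succ t ih =>
    obtain ⟨x, y, h⟩ := ih
    rw [info_succ, nextInfo]
    split_ifs
    · exact ⟨_, _, LastCredible.snoc_some _ _⟩
    · exact ⟨_, _, h.snoc_none⟩

theorem lastCredible_info (P : Primitives M μ) (g : Strategy S n) (d : EmpDist S n) (t : ℕ)
    (ω : Ω) : LastCredible (P.info g t ω).1 (lastCredible d t (P.info g t ω).1).1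
      (lastCredible d t (P.info g t ω).1).2 := by
  obtain ⟨x, y, h⟩ := P.exists_lastCredible_info g t ω
  simpa [h.lastCredible_eq d] using h

theorem action_eq_of_follows (P : Primitives M μ) {g : Strategy S n} {k : ℕ}
    {φ : EmpDist S n → Fin (k + 1) → Bool} (hg : g.Follows φ) (d : EmpDist S n) (t : ℕ) (ω : Ω)
    (h : (lastCredible d t (P.info g t ω).1).2 < k + 1) :
    P.action g t ω = φ (lastCredible d t (P.info g t ω).1).1 ⟨_, h⟩ :=
  hg t _ _ _ ⟨_, h⟩ (P.lastCredible_info g d t ω)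

variable [MeasurableSingletonClass S]

/-- The estimate depends on ω only through the information, so the cost is a function of a
finite-valued variable. -/
theorem measurable_cost (P : Primitives M μ) (g : Strategy S n) (t : ℕ) :
    Measurable fun ω => M.c (P.data t ω) (P.estimate g t ω) (P.action g t ω) :=
  (measurable_from_top (f := fun p : Info S n t × EmpDist S n =>
    M.c p.2 (M.h fun m' => (cond μ {ω' | P.info g t ω' = p.1}).real {ω' | P.data t ω' = m'})
      (g t p.1.1 p.1.2))).comp
    (measurable_top_prodMk (P.measurable_info g t) (P.measurable_data t))

variable [IsProbabilityMeasure μ]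

/-- Testing `integral_info_data` with the indicator of one information value and one data value
gives the joint probability; dividing by the probability of the information needs a non-null atom,
hence the almost sure form. -/
theorem posterior_ae_eq (P : Primitives M μ) (hex : M.Exchangeable) (g : Strategy S n)
    (d : EmpDist S n) (t : ℕ) :
    ∀ᵐ ω ∂μ, P.posterior g t ω = fun m =>
      (M.T ^ (lastCredible d t (P.info g t ω).1).2) m (lastCredible d t (P.info g t ω).1).1 := by
  classical
  filter_upwards [ae_measure_fiber_ne_zero (μ := μ) (P.info g t)] with ω hω
  funext m
  have hI : MeasurableSet {ω' | P.info g t ω' = P.info g t ω} :=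
    P.measurable_info g t (MeasurableSpace.measurableSet_top (s := {P.info g t ω}))
  have hm : MeasurableSet {ω' | P.data t ω' = m} :=
    P.measurable_data t (MeasurableSpace.measurableSet_top (s := {m}))
  have hI0 : μ.real {ω' | P.info g t ω' = P.info g t ω} ≠ 0 :=
    (measureReal_ne_zero_iff (measure_ne_top _ _)).2 hω
  have key := P.integral_info_data hex g d t
    (fun I m' => if I = P.info g t ω ∧ m' = m then 1 else 0)
  have e1 : (fun ω' => if P.info g t ω' = P.info g t ω ∧ P.data t ω' = m then (1 : ℝ) else 0)
      = Set.indicator ({ω' | P.info g t ω' = P.info g t ω} ∩ {ω' | P.data t ω' = m}) 1 := by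
    funext ω'
    simp [Set.indicator_apply]
  have e2 : (fun ω' => ∑ m', (M.T ^ (lastCredible d t (P.info g t ω').1).2) m'
        (lastCredible d t (P.info g t ω').1).1
          * (if P.info g t ω' = P.info g t ω ∧ m' = m then (1 : ℝ) else 0))
      = Set.indicator {ω' | P.info g t ω' = P.info g t ω}
          fun _ => (M.T ^ (lastCredible d t (P.info g t ω).1).2) m
            (lastCredible d t (P.info g t ω).1).1 := by
    funext ω'
    by_cases h : P.info g t ω' = P.info g t ω <;> simp [h]
  rw [e1, e2, integral_indicator_one (hI.inter hm), integral_indicator_const _ hI,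
    smul_eq_mul] at key
  rw [posterior, measureReal_def, cond_apply hI, ENNReal.toReal_mul, ENNReal.toReal_inv,
    ← measureReal_def, ← measureReal_def, key, inv_mul_cancel_left₀ hI0]

theorem integral_cost (P : Primitives M μ) (hex : M.Exchangeable) (g : Strategy S n)
    (d : EmpDist S n) (t : ℕ) :
    ∫ ω, M.c (P.data t ω) (P.estimate g t ω) (P.action g t ω) ∂μ
      = ∫ ω, M.cHat (lastCredible d t (P.info g t ω).1).1 (lastCredible d t (P.info g t ω).1).2
          (P.action g t ω) ∂μ := by
  have h1 := P.integral_info_data hex g d t (fun I m =>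
    M.c m (M.h fun m' => (cond μ {ω' | P.info g t ω' = I}).real {ω' | P.data t ω' = m'})
      (g t I.1 I.2))
  refine h1.trans (integral_congr_ae ?_)
  filter_upwards [P.posterior_ae_eq hex g d t] with ω hω
  unfold posterior at hω
  simp only [hω, Model.cHat, action]
  exact Finset.sum_congr rfl fun m _ => mul_comm _ _

/-- The controlled Markov property of (x, y), in integrated form. -/
theorem integral_value_succ (P : Primitives M μ) (hex : M.Exchangeable) (g : Strategy S n)
    (d : EmpDist S n) (t : ℕ) (U : EmpDist S n → ℕ → ℝ) :
    ∫ ω, U (lastCredible d (t + 1) (P.info g (t + 1) ω).1).1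
        (lastCredible d (t + 1) (P.info g (t + 1) ω).1).2 ∂μ
      = ∫ ω, M.expectedNext (lastCredible d t (P.info g t ω).1).1
          (lastCredible d t (P.info g t ω).1).2 (P.action g t ω)
          (U (lastCredible d t (P.info g t ω).1).1 ((lastCredible d t (P.info g t ω).1).2 + 1))
          (fun m => U m 0) ∂μ := by
  have h1 := P.integral_info_next hex g d t (fun I m b =>
    U (lastCredible d (t + 1) (nextInfo g t I m b).1).1
      (lastCredible d (t + 1) (nextInfo g t I m b).1).2)
  refine h1.trans ?_
  congr 1
  funext ω
  simp only [Fintype.sum_bool, Finset.sum_add_distrib, Model.expectedNext, action]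
  cases h : g t (P.info g t ω).1 (P.info g t ω).2 <;>
    simp only [nextInfo, h, and_self, and_false, false_and, Bool.false_eq_true, if_true, if_false,
      lastCredible_snoc_some, lastCredible_snoc_none, Model.credWeight, Model.successProb,
      ← Finset.sum_mul, M.sum_T_pow, Finset.mul_sum]
  · simp
    ring
  · rw [add_comm, one_mul]
    congr 1
    exact Finset.sum_congr rfl fun m _ => by ring

/-- Geometric domination by γ^t cmax justifies exchanging sum and integral. -/
theorem hasSum_integral_cost (P : Primitives M μ) (g : Strategy S n) {cmax : ℝ}
    (hc : ∀ m m' a, M.c m m' a ≤ cmax) :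
    HasSum (fun t => M.γ ^ t * ∫ ω, M.c (P.data t ω) (P.estimate g t ω) (P.action g t ω) ∂μ)
      (P.J g) := by
  have hb : ∀ t ω, ‖M.γ ^ t * M.c (P.data t ω) (P.estimate g t ω) (P.action g t ω)‖
      ≤ M.γ ^ t * cmax := by
    intro t ω
    have hγ := pow_nonneg M.γ_mem.1.le t
    rw [Real.norm_of_nonneg (mul_nonneg hγ (M.c_nonneg _ _ _))]
    exact mul_le_mul_of_nonneg_left (hc _ _ _) hγ
  have hint : ∀ t, Integrable
      (fun ω => M.γ ^ t * M.c (P.data t ω) (P.estimate g t ω) (P.action g t ω)) μ := fun t =>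
    Integrable.of_bound ((P.measurable_cost g t).const_mul _).aestronglyMeasurable _
      (Filter.Eventually.of_forall (hb t))
  have hs : Summable fun t => ∫ ω, ‖M.γ ^ t * M.c (P.data t ω) (P.estimate g t ω)
      (P.action g t ω)‖ ∂μ := by
    refine Summable.of_nonneg_of_le (fun t => integral_nonneg fun ω => norm_nonneg _) (fun t => ?_)
      ((summable_geometric_of_lt_one M.γ_mem.1.le M.γ_mem.2).mul_right cmax)
    calc _ ≤ ∫ _, M.γ ^ t * cmax ∂μ :=
          integral_mono (hint t).norm (integrable_const _) (hb t)
      _ = _ := by simp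
  have h := hasSum_integral_of_summable_integral_norm hint hs
  simp only [integral_const_mul] at h
  exact h

theorem integrable_value (P : Primitives M μ) (g : Strategy S n) (d : EmpDist S n) (t : ℕ)
    (F : EmpDist S n → ℕ → Bool → ℝ) :
    Integrable (fun ω => F (lastCredible d t (P.info g t ω).1).1
      (lastCredible d t (P.info g t ω).1).2 (P.action g t ω)) μ :=
  integrable_comp_of_finite (P.measurable_info g t) fun I =>
    F (lastCredible d t I.1).1 (lastCredible d t I.1).2 (g t I.1 I.2)

theorem integral_step (P : Primitives M μ) (hex : M.Exchangeable) (g : Strategy S n)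
    (d : EmpDist S n) (t : ℕ) (U : EmpDist S n → ℕ → ℝ) :
    (∫ ω, M.c (P.data t ω) (P.estimate g t ω) (P.action g t ω) ∂μ)
        + M.γ * ∫ ω, U (lastCredible d (t + 1) (P.info g (t + 1) ω).1).1
          (lastCredible d (t + 1) (P.info g (t + 1) ω).1).2 ∂μ
      = ∫ ω, (M.cHat (lastCredible d t (P.info g t ω).1).1 (lastCredible d t (P.info g t ω).1).2
          (P.action g t ω) + M.γ * M.expectedNext (lastCredible d t (P.info g t ω).1).1
          (lastCredible d t (P.info g t ω).1).2 (P.action g t ω)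
          (U (lastCredible d t (P.info g t ω).1).1 ((lastCredible d t (P.info g t ω).1).2 + 1))
          (fun m => U m 0)) ∂μ := by
  rw [P.integral_cost hex g d t, P.integral_value_succ hex g d t U, ← integral_const_mul,
    ← integral_add (P.integrable_value g d t M.cHat) (P.integrable_value g d t fun x y a =>
      M.γ * M.expectedNext x y a (U x (y + 1)) fun m => U m 0)]

omit [MeasurableSingletonClass S] in
theorem abs_integral_value_le (P : Primitives M μ) (g : Strategy S n) (d : EmpDist S n) (t : ℕ)
    {U : EmpDist S n → ℕ → ℝ} {K : ℝ} (hU : ∀ x y, |U x y| ≤ K) :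
    |∫ ω, U (lastCredible d t (P.info g t ω).1).1 (lastCredible d t (P.info g t ω).1).2 ∂μ|
      ≤ K := by
  simpa using norm_integral_le_of_norm_le_const (μ := μ)
    (f := fun ω => U (lastCredible d t (P.info g t ω).1).1
      (lastCredible d t (P.info g t ω).1).2)
    (Filter.Eventually.of_forall fun ω => hU (lastCredible d t (P.info g t ω).1).1
      (lastCredible d t (P.info g t ω).1).2)

/-- A bounded function of the last credible data and its age that decreases in expectation under
the strategy bounds its cost from above. -/
theorem J_le_of_superharmonic (P : Primitives M μ) (hex : M.Exchangeable) (g : Strategy S n)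
    (d : EmpDist S n) {cmax : ℝ} (hc : ∀ m m' a, M.c m m' a ≤ cmax) {U : EmpDist S n → ℕ → ℝ}
    {K : ℝ} (hU : ∀ x y, |U x y| ≤ K)
    (h : ∀ t ω x y, lastCredible d t (P.info g t ω).1 = (x, y) →
      M.cHat x y (P.action g t ω) + M.γ * M.expectedNext x y (P.action g t ω) (U x (y + 1))
        (fun m => U m 0) ≤ U x y) :
    P.J g ≤ ∫ ω, U (P.data 0 ω) 0 ∂μ := by
  -- At time 0 the information state is (m, 0) with m the initial data, so E 0 is the claimed bound
  -- by unfolding.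
  refine le_of_discounted_step_le M.γ_mem.1.le M.γ_mem.2
    (E := fun t => ∫ ω, U (lastCredible d t (P.info g t ω).1).1
      (lastCredible d t (P.info g t ω).1).2 ∂μ) (fun t => ?_)
    (fun t => P.abs_integral_value_le g d t hU) (P.hasSum_integral_cost g hc)
  rw [P.integral_step hex g d t U]
  exact integral_mono
    (P.integrable_value g d t fun x y a =>
      M.cHat x y a + M.γ * M.expectedNext x y a (U x (y + 1)) fun m => U m 0)
    (P.integrable_value g d t fun x y _ => U x y) fun ω => h t ω _ _ rfl

/-- A bounded function of the last credible data and its age that increases in expectation under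
the strategy bounds its cost from below. -/
theorem le_J_of_subharmonic (P : Primitives M μ) (hex : M.Exchangeable) (g : Strategy S n)
    (d : EmpDist S n) {cmax : ℝ} (hc : ∀ m m' a, M.c m m' a ≤ cmax) {U : EmpDist S n → ℕ → ℝ}
    {K : ℝ} (hU : ∀ x y, |U x y| ≤ K)
    (h : ∀ x y a, U x y ≤ M.cHat x y a + M.γ * M.expectedNext x y a (U x (y + 1))
      (fun m => U m 0)) :
    ∫ ω, U (P.data 0 ω) 0 ∂μ ≤ P.J g := by
  have hsum := (P.hasSum_integral_cost g hc).neg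
  simp only [← mul_neg] at hsum
  refine neg_le_neg_iff.1 (le_of_discounted_step_le M.γ_mem.1.le M.γ_mem.2
    (E := fun t => -∫ ω, U (lastCredible d t (P.info g t ω).1).1
      (lastCredible d t (P.info g t ω).1).2 ∂μ) (K := K) (fun t => ?_)
    (fun t => (abs_neg _).trans_le (P.abs_integral_value_le g d t hU)) hsum)
  rw [mul_neg, ← neg_add, neg_le_neg_iff, P.integral_step hex g d t U]
  exact integral_mono (P.integrable_value g d t fun x y _ => U x y)
    (P.integrable_value g d t fun x y a =>
      M.cHat x y a + M.γ * M.expectedNext x y a (U x (y + 1)) fun m => U m 0)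
    fun ω => h _ _ _

end Primitives

/-! ### The choice of k and the conclusion -/

theorem pow_le_of_log_div_log_le {γ A : ℝ} (hγ0 : 0 < γ) (hγ1 : γ < 1) (hA : 0 < A) {k : ℕ}
    (hk : Real.log A / Real.log γ ≤ k) : γ ^ k ≤ A := by
  rw [div_le_iff_of_neg (Real.log_neg hγ0 hγ1), ← Real.log_pow] at hk
  exact (Real.log_le_log_iff (pow_pos hγ0 k) hA).1 hk

end SampledNetwork

theorem theorem3 {S W Ω : Type*} [Fintype S] [MeasurableSpace S] [MeasurableSingletonClass S]
    [MeasurableSpace W] [MeasurableSpace Ω] {n : ℕ} [NeZero n]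
    (M : Model S W n) (hex : M.Exchangeable)
    (μ : Measure Ω) [IsProbabilityMeasure μ] (P : Primitives M μ)
    (cmax : ℝ) (hcmax : 0 < cmax) (hc : ∀ m m' a, M.c m m' a ≤ cmax)
    (ε : ℝ) (hε : 0 < ε) (k : ℕ)
    (hk : (k : ℝ) ≥ Real.log ((1 - M.γ) * ε / (2 * cmax)) / Real.log M.γ)
    (mStar : EmpDist S n) (V : EmpDist S n → Fin (k + 1) → ℝ)
    (hV : M.IsBellmanSolution mStar V) :
    (∃ g : Strategy S n, g.Follows (M.greedy mStar V)) ∧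
      ∀ g : Strategy S n, g.Follows (M.greedy mStar V) →
        ∀ g' : Strategy S n, P.J g ≤ P.J g' + ε := by
  refine ⟨Strategy.exists_follows mStar _, fun g hg g' => ?_⟩
  obtain ⟨hγ0, hγ1⟩ := M.γ_mem
  have h1γ : 0 < 1 - M.γ := sub_pos.2 hγ1
  set C : ℝ := cmax / (1 - M.γ) with hCdef
  have hCmul : C * (1 - M.γ) = cmax := div_mul_cancel₀ _ h1γ.ne'
  have hC : cmax + M.γ * C = C := by linarith
  have hC0 : 0 ≤ C := (div_pos hcmax h1γ).le
  have hVC := hV.le_bound hc hC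
  have hpow : ∀ y, 0 ≤ M.γ ^ y * C := fun y => mul_nonneg (pow_nonneg hγ0.le y) hC0
  have hUabs : ∀ x y, |M.upperValue V C x y| ≤ C := fun x y => by
    rw [abs_of_nonneg]
    · exact M.upperValue_le x y
    · rw [Model.upperValue]
      split_ifs with h
      · exact le_min hC0 (add_nonneg (hV.nonneg x _) (hpow _))
      · exact hC0
  have hLabs : ∀ x y, |M.lowerValue V C x y| ≤ C := fun x y => by
    rw [abs_of_nonneg (M.lowerValue_nonneg x y), Model.lowerValue]
    split_ifs with h
    · exact max_le hC0 (by linarith [hVC x ⟨y, h⟩, hpow (k + 1 - y)])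
    · exact hC0
  have h1 := P.J_le_of_superharmonic hex g mStar hc hUabs fun t ω x y hxy =>
    hV.upperValue_superharmonic hc hC hC0 x y _ fun h => by
      have h' := P.action_eq_of_follows hg mStar t ω (by rw [hxy]; exact h)
      simpa only [hxy] using h'
  have h2 := P.le_J_of_subharmonic hex g' mStar hc hLabs
    fun x y a => hV.lowerValue_subharmonic hVC hC0 x y a
  -- The initial data do not depend on the strategy, so the two bounds can be compared pointwise.
  have h3 : ∫ ω, M.upperValue V C (P.data 0 ω) 0 ∂μ
      ≤ ∫ ω, M.lowerValue V C (P.data 0 ω) 0 + 2 * (M.γ ^ (k + 1) * C) ∂μ :=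
    integral_mono (integrable_comp_of_finite (P.measurable_data 0) fun m => M.upperValue V C m 0)
      (integrable_comp_of_finite (P.measurable_data 0) fun m =>
        M.lowerValue V C m 0 + 2 * (M.γ ^ (k + 1) * C))
      fun ω => by
        have hu := M.upperValue_zero_le (V := V) (C := C) (P.data 0 ω)
        have hl := M.le_lowerValue_zero (V := V) (C := C) (P.data 0 ω)
        dsimp only
        linarith
  rw [integral_add (integrable_comp_of_finite (P.measurable_data 0) fun m => M.lowerValue V C m 0)
    (integrable_const _), integral_const, probReal_univ, one_smul] at h3
  have h4 : M.γ ^ k ≤ (1 - M.γ) * ε / (2 * cmax) :=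
    pow_le_of_log_div_log_le hγ0 hγ1 (by positivity) hk
  have h5 : 2 * (M.γ ^ k * C) ≤ ε := by
    calc 2 * (M.γ ^ k * C) ≤ 2 * ((1 - M.γ) * ε / (2 * cmax) * C) := by gcongr
      _ = ε := by
        rw [hCdef]
        field_simp
  -- The hypothesis on k controls γ^k, one factor γ more than the gap requires.
  have h6 : M.γ ^ (k + 1) * C ≤ M.γ ^ k * C := M.pow_mul_le_pow_mul hC0 k.le_succ
  linarith
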